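/- Let $G$ be a finite digraph (at most one edge $ij$ from $i$ to $j$ for each ordered pair of vertices) with vertex set $V(G)$ and edge set $E(G)$, in which every vertex $u$ has outdegree $d_u^+(G)>0$. An oriented spanning tree of $G$ with root $u$ is a subdigraph containing all vertices whose underlying undirected graph is a tree, in which $u$ has outdegree $0$ and every other vertex has outdegree $1$. Let $\kappa_u(G)$ be the number of oriented spanning trees of $G$ with root $u$. For a digraph $H$ with edge weights $w_e(H)$, let $t_u(H)=\sum_T\prod_{e\in E(T)}w_e(H)$, the sum being over all oriented spanning trees $T$ of $H$ with root $u$. A biclique $Q$ is a digraph whose vertex set is partitioned into two nonempty disjoint parts $Q^{(1)},Q^{(2)}$ and whose edges are all pairs $ij$ with $i\in Q^{(1)}$, $j\in Q^{(2)}$. A biclique partition of $G$ is a set $\varepsilon=\{Q_1,\dots,Q_r\}$ of $r$ distinct bicliques that are subdigraphs of $G$, such that each edge of $G$ belongs to exactly one of them. Given such an $\varepsilon$, let $\Theta(\varepsilon)$ be the weighted digraph with vertex set $\varepsilon$, with an edge $Q_iQ_j$ whenever $Q_i^{(2)}\cap Q_j^{(1)}\neq\emptyset$, of weight $$w_{Q_iQ_j}(\Theta(\varepsilon))=|Q_j^{(2)}|\sum_{u\in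 Q_i^{(2)}\cap Q_j^{(1)}}\frac1{d_u^+(G)}.$$ Then: (1) For every $u\in V(G)$, $$\kappa_u(G)=\frac{\prod_{v\in V(G),\,v\ne u}d_v^+(G)}{\prod_{j=1}^r|Q_j^{(2)}|}\sum_{i:\,u\in Q_i^{(2)}}t_{Q_i}(\Theta(\varepsilon)).$$ (2) For every $Q_i\in\varepsilon$, $$t_{Q_i}(\Theta(\varepsilon))=\frac{\prod_{j=1}^r|Q_j^{(2)}|}{\prod_{u\in V(G)}d_u^+(G)}\sum_{u\in Q_i^{(1)}}\kappa_u(G).$$ -/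

import Mathlib

namespace BicliqueTrees

/-- The outdegree of the vertex `v` in the digraph `G`. -/
noncomputable def outDegree {V : Type*} [Fintype V] (G : Digraph V) (v : V) : ℕ := by
  classical exact (Finset.univ.filter fun x => G.Adj v x).card

/-- `T`, viewed as a set of directed edges (tail, head) on the whole vertex set `V`, is an oriented
spanning tree of `G` with root `u`: its edges are edges of `G`, its underlying undirected graph is
a tree containing all vertices, the root has outdegree 0 and every other vertex has
outdegree 1. -/
structure IsOrientedSpanningTree {V : Type*} (G : Digraph V) (u : V) (T : Finset (V × V)) :
    Prop where
  subgraph : ∀ e ∈ T, G.Adj e.1 e.2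
  tree : (SimpleGraph.fromRel fun a b => (a, b) ∈ T).IsTree
  root : ∀ x, (u, x) ∉ T
  nonroot : ∀ v, v ≠ u → ∃! x, (v, x) ∈ T

/-- The finite set of oriented spanning trees of `G` with root `u`. -/
noncomputable def orientedSpanningTrees {V : Type*} [Fintype V] (G : Digraph V) (u : V) :
    Finset (Finset (V × V)) := by
  classical exact Finset.univ.filter fun T => IsOrientedSpanningTree G u T

/-- The number `κ_u(G)` of oriented spanning trees of `G` with root `u`. -/
noncomputable def kappa {V : Type*} [Fintype V] (G : Digraph V) (u : V) : ℕ :=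
  (orientedSpanningTrees G u).card

/-- A digraph with edge weights in `R`; only the weights of edges are meaningful. -/
structure WeightedDigraph (V R : Type*) extends Digraph V where
  weight : V → V → R

/-- The spanning tree enumerator `t_u(G)`: the sum over the oriented spanning trees with root `u`
of the product of the weights of their edges. -/
noncomputable def treeEnumerator {V R : Type*} [Fintype V] [CommSemiring R]
    (G : WeightedDigraph V R) (u : V) : R :=
  ∑ T ∈ orientedSpanningTrees G.toDigraph u, ∏ e ∈ T, G.weight e.1 e.2

/-- A biclique on vertices of `V`, given by its two parts `Q⁽¹⁾` and `Q⁽²⁾`, which are disjoint and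
nonempty. -/
@[ext] structure Biclique (V : Type*) where
  part1 : Finset V
  part2 : Finset V
  nonempty1 : part1.Nonempty
  nonempty2 : part2.Nonempty
  disjoint : Disjoint part1 part2

/-- The edges of a biclique: all pairs from the first part to the second. -/
def Biclique.toDigraph {V : Type*} (Q : Biclique V) : Digraph V where
  Adj i j := i ∈ Q.part1 ∧ j ∈ Q.part2

/-- `ε` is a biclique partition of `G`: a finite set of bicliques in `G` such that each edge of `G`
belongs to exactly one of them. -/
structure IsBicliquePartition {V : Type*} (G : Digraph V) (ε : Finset (Biclique V)) : Prop where
  subgraph : ∀ Q ∈ ε, ∀ i j, Q.toDigraph.Adj i j → G.Adj i j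
  exists_unique : ∀ i j, G.Adj i j → ∃! Q, Q ∈ ε ∧ Q.toDigraph.Adj i j

/-- The weighted biclique digraph `Θ(ε)`: its vertices are the members of `ε`, there is an edge
from `P` to `Q` when `P⁽²⁾ ∩ Q⁽¹⁾` is nonempty, and that edge has weight
`|Q⁽²⁾| * ∑ u ∈ P⁽²⁾ ∩ Q⁽¹⁾, 1 / d_u⁺(G)`. -/
noncomputable def Theta {V : Type*} [Fintype V] [DecidableEq V] (G : Digraph V)
    (ε : Finset (Biclique V)) : WeightedDigraph ε ℚ where
  Adj P Q := (P.1.part2 ∩ Q.1.part1).Nonempty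
  weight P Q := (Q.1.part2.card : ℚ) * ∑ u ∈ P.1.part2 ∩ Q.1.part1, 1 / (outDegree G u : ℚ)

end BicliqueTrees

/-! By the matrix tree theorem, rooted tree counts are diagonal entries of the adjugate of a
Laplacian `L`. Since `L` kills the all-ones vector, each column of its adjugate is constant, so the
diagonal determines it. Let `B` and `C` be the incidence matrices of first and second parts, `D` the
outdegrees and `M` the sizes of second parts. A biclique partition amounts to `B * C` being the
adjacency matrix, so the Laplacians are `D - B * C` for `G` and `M - C * D⁻¹ * B * M` for `Θ(ε)`.
Both are singular; replacing `C` by `C - E`, with `E` a single matrix unit in row `Q`, turns their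
determinants into `∑ κ_u` over `Q⁽¹⁾` and `t_Q`. The identity `det (1 - X * Y) = det (1 - Y * X)`
compares the two and gives (2), in `prod_card_mul_sum_kappa`. Then (1) follows by summing (2) over
the bicliques with `u` in the second part, using the balance equation `sum_kappa_mul_weight`. -/

open Finset Matrix

namespace BicliqueTrees

/-! ### Rooted trees as functional graphs, and their determinants -/

section FunctionalGraph

variable {V R : Type*} [DecidableEq V] [CommRing R]

/-- The edges of the functional graph of `f`, except the one that starts at `u`. -/
def mapEdges [Fintype V] (u : V) (f : V → V) : Finset (V × V) :=
  (univ.erase u).image fun v => (v, f v)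

theorem mem_mapEdges [Fintype V] {u : V} {f : V → V} {a b : V} :
    (a, b) ∈ mapEdges u f ↔ a ≠ u ∧ f a = b := by
  simp only [mapEdges, mem_image, mem_erase, mem_univ, and_true, Prod.mk.injEq]
  constructor
  · rintro ⟨v, hv, rfl, rfl⟩
    exact ⟨hv, rfl⟩
  · rintro ⟨h, rfl⟩
    exact ⟨a, h, rfl, rfl⟩

/-- Iterating `f` leads from every point to `u`. -/
def LeadsTo (u : V) (f : V → V) : Prop := ∀ v, ∃ k, f^[k] v = u

omit [DecidableEq V] in
theorem exists_iterate_apply_iff {u : V} {f : V → V} {v : V} (h : v ≠ u) :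
    (∃ k, f^[k] (f v) = u) ↔ ∃ k, f^[k] v = u := by
  constructor
  · rintro ⟨k, hk⟩
    exact ⟨k + 1, hk⟩
  · rintro ⟨k, hk⟩
    cases k with
    | zero => exact absurd hk h
    | succ k => exact ⟨k, hk⟩

/-- A functional graph is a tree rooted at `u` exactly if iteration leads to `u`. -/
theorem isTree_mapEdges_iff [Fintype V] {u : V} {f : V → V} :
    (SimpleGraph.fromRel fun a b => (a, b) ∈ mapEdges u f).IsTree ↔ LeadsTo u f := by
  set H := SimpleGraph.fromRel fun a b => (a, b) ∈ mapEdges u f with hH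
  have hadj : ∀ a b, H.Adj a b ↔ a ≠ b ∧ ((a ≠ u ∧ f a = b) ∨ (b ≠ u ∧ f b = a)) := by
    intro a b
    rw [hH, SimpleGraph.fromRel_adj, mem_mapEdges, mem_mapEdges]
  constructor
  · intro h v
    have key : ∀ a b, H.Adj a b → ((∃ k, f^[k] a = u) ↔ ∃ k, f^[k] b = u) := by
      intro a b hab
      rcases ((hadj a b).1 hab).2 with ⟨h, rfl⟩ | ⟨h, rfl⟩
      · exact (exists_iterate_apply_iff h).symm
      · exact exists_iterate_apply_iff h
    obtain ⟨p⟩ := h.connected.preconnected v u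
    have walk : ∀ a b, H.Walk a b → ((∃ k, f^[k] a = u) ↔ ∃ k, f^[k] b = u) := by
      intro a b p
      induction p with
      | nil => rfl
      | cons h _ ih => exact (key _ _ h).trans ih
    exact (walk _ _ p).2 ⟨0, rfl⟩
  · intro h
    have reach : ∀ k v, f^[k] v = u → H.Reachable v u := by
      intro k
      induction k with
      | zero => rintro v rfl; exact SimpleGraph.Reachable.refl _
      | succ k ih =>
        intro v hv
        by_cases hvu : v = u
        · rw [hvu]
        · have h1 := ih (f v) hv
          by_cases hf : v = f v
          · rwa [← hf] at h1
          · exact (SimpleGraph.Adj.reachable ((hadj _ _).2 ⟨hf, Or.inl ⟨hvu, rfl⟩⟩)).trans h1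
    have hr : ∀ v, H.Reachable v u := fun v => (h v).elim fun k hk => reach k v hk
    have hc : H.Connected :=
      { preconnected := fun a b => (hr a).trans (hr b).symm, nonempty := ⟨u⟩ }
    -- Connectedness bounds the number of edges below; above, every edge is `s(v, f v)` for some `v
    -- ≠ u`.
    refine SimpleGraph.isTree_iff_connected_and_card.2
      ⟨hc, le_antisymm ?_ hc.card_vert_le_card_edgeSet_add_one⟩
    have hsub : H.edgeSet ⊆ ((univ.erase u).image fun v => s(v, f v) : Finset (Sym2 V)) := by
      intro e
      induction e with
      | _ a b =>
        intro hab
        rw [SimpleGraph.mem_edgeSet, hadj] at hab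
        rw [mem_coe, mem_image]
        rcases hab.2 with ⟨h, rfl⟩ | ⟨h, rfl⟩
        · exact ⟨a, by simp [h], rfl⟩
        · exact ⟨b, by simp [h], Sym2.eq_swap⟩
    have h1 : Nat.card H.edgeSet ≤ (univ.erase u).card := by
      rw [Nat.card_coe_set_eq]
      refine (Set.ncard_le_ncard hsub (Finset.finite_toSet _)).trans ?_
      rw [Set.ncard_coe_finset]
      exact card_image_le
    have h2 := card_erase_add_one (mem_univ u)
    rw [Nat.card_eq_fintype_card (α := V), ← card_univ]
    omega

/-- `1 - P` with row `u` replaced by the unit vector, for the transition matrix `P` of `f`. -/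
def mapMatrix (R : Type*) [CommRing R] (u : V) (f : V → V) : Matrix V V R :=
  of fun v => if v = u then Pi.single u 1 else Pi.single v 1 - Pi.single (f v) 1

/-- Each step of `f` away from a vertex other than `u` lowers the distance `d` to `u`, so grading by
`d` makes the matrix block triangular with identity blocks. -/
theorem det_mapMatrix_of_leadsTo [Fintype V] {u : V} {f : V → V} (h : LeadsTo u f) :
    (mapMatrix R u f).det = 1 := by
  classical
  let d : V → ℕ := fun v => Nat.find (h v)
  have hd : ∀ v, v ≠ u → d (f v) < d v := by
    intro v hv
    have h1 : f^[d v] v = u := Nat.find_spec (h v)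
    cases hk : d v with
    | zero => rw [hk] at h1; exact absurd h1 hv
    | succ k =>
      rw [hk] at h1
      exact Nat.lt_succ_of_le (Nat.find_min' (h (f v)) h1)
  have entry : ∀ i j, d i ≤ d j → mapMatrix R u f i j = (1 : Matrix V V R) i j := by
    intro i j hij
    by_cases hi : i = u
    · subst hi
      simp [mapMatrix, Matrix.one_apply, Pi.single_apply, eq_comm]
    · have : j ≠ f i := fun hj => by
        have := hd i hi
        rw [← hj] at this
        omega
      simp [mapMatrix, Matrix.one_apply, Pi.single_apply, hi, this, eq_comm (a := j)]
  have htri : (mapMatrix R u f).BlockTriangular (fun v => OrderDual.toDual (d v)) := by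
    intro i j hij
    have hij' : d i < d j := hij
    rw [entry i j hij'.le, Matrix.one_apply_ne]
    rintro rfl
    exact lt_irrefl _ hij'
  rw [htri.det]
  refine prod_eq_one fun a _ => ?_
  have h1 : (mapMatrix R u f).toSquareBlock (fun v => OrderDual.toDual (d v)) a = 1 := by
    ext i j
    have : d i.1 = d j.1 := OrderDual.toDual.injective (i.2.trans j.2.symm)
    rw [Matrix.toSquareBlock_def, of_apply, entry _ _ this.le]
    simp [Matrix.one_apply, Subtype.ext_iff]
  rw [h1, Matrix.det_one]

/-- The indicator of the vertices that never reach `u` is a nonzero kernel vector: it vanishes at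
`u` and agrees at `v` and `f v` for `v ≠ u`. -/
theorem det_mapMatrix_of_not_leadsTo [IsDomain R] [Fintype V] {u : V} {f : V → V}
    (h : ¬ LeadsTo u f) : (mapMatrix R u f).det = 0 := by
  classical
  rw [← Matrix.exists_mulVec_eq_zero_iff]
  refine ⟨fun v => if ∃ k, f^[k] v = u then 0 else 1, fun h0 => h fun v => ?_, ?_⟩
  · by_contra hv
    have := congrFun h0 v
    simp [hv] at this
  · ext v
    by_cases hv : v = u
    · subst hv
      have : ∃ k, f^[k] v = v := ⟨0, rfl⟩
      simp [mapMatrix, Matrix.mulVec, this]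
    · have h1 : mapMatrix R u f v = Pi.single v 1 - Pi.single (f v) 1 :=
        if_neg hv
      rw [mulVec, h1, sub_dotProduct, single_one_dotProduct, single_one_dotProduct,
        Pi.zero_apply, sub_eq_zero]
      simp only [exists_iterate_apply_iff hv]

end FunctionalGraph

/-! ### The matrix tree theorem and adjugates of Laplacians -/

section MatrixTree

variable {V R : Type*} [DecidableEq V] [Fintype V] [CommRing R]

/-- The Laplacian of the complete digraph with edge weights `w`. -/
def laplacian (w : V → V → R) : Matrix V V R :=
  diagonal (fun v => ∑ x, w v x) - of w

theorem laplacian_row (w : V → V → R) (v : V) :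
    laplacian w v = ∑ x, w v x • (Pi.single v 1 - Pi.single x 1) := by
  ext y
  simp only [laplacian, Matrix.sub_apply, diagonal_apply, of_apply, Finset.sum_apply,
    Pi.smul_apply, Pi.sub_apply, Pi.single_apply, smul_eq_mul, mul_sub, sum_sub_distrib]
  simp [eq_comm (a := y)]

theorem laplacian_mulVec_one (w : V → V → R) : laplacian w *ᵥ 1 = 0 := by
  ext v
  rw [laplacian, sub_mulVec, Pi.sub_apply, mulVec_diagonal]
  simp [mulVec, dotProduct]

/-- Every row other than `u` is a weighted sum over possible successors. Multilinearity of the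
determinant expands it over maps `f`, and each resulting determinant is 1 or 0 according to `LeadsTo
u f`. -/
theorem adjugate_laplacian_diag [IsDomain R] (w : V → V → R) (u : V)
    [DecidablePred (LeadsTo (V := V) u)] :
    (laplacian w).adjugate u u =
      ∑ f ∈ (Fintype.piFinset fun v => if v = u then {u} else univ) with LeadsTo u f,
        ∏ v ∈ univ.erase u, w v (f v) := by
  have h1 : (laplacian w).updateRow u (Pi.single u 1) = fun v =>
      ∑ x ∈ (if v = u then {u} else univ : Finset V),
        (if v = u then 1 else w v x) •
          (if v = u then Pi.single u 1 else Pi.single v 1 - Pi.single x 1 : V → R) := by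
    funext v
    by_cases hv : v = u
    · subst hv
      simp
    · simp [hv, updateRow_ne, laplacian_row]
  rw [adjugate_apply, h1, sum_filter]
  refine (MultilinearMap.map_sum_finset (detRowAlternating (n := V) (R := R)).toMultilinearMap
    _ _).trans (sum_congr rfl fun f _ => ?_)
  refine (MultilinearMap.map_smul_univ _ _ _).trans ?_
  have h2 : (∏ v, if v = u then 1 else w v (f v)) = ∏ v ∈ univ.erase u, w v (f v) := by
    rw [← mul_prod_erase _ _ (mem_univ u), if_pos rfl, one_mul]
    exact prod_congr rfl fun v hv => if_neg (ne_of_mem_erase hv)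
  rw [h2]
  change _ • (mapMatrix R u f).det = _
  split_ifs with hf
  · rw [det_mapMatrix_of_leadsTo hf, smul_eq_mul, mul_one]
  · rw [det_mapMatrix_of_not_leadsTo hf, smul_zero]

/-- The **matrix tree theorem** for weighted digraphs. -/
theorem treeEnumerator_eq_adjugate [IsDomain R] (G : WeightedDigraph V R)
    (hw : ∀ a b, ¬ G.Adj a b → G.weight a b = 0) (u : V) :
    treeEnumerator G u = (laplacian G.weight).adjugate u u := by
  classical
  have hprod : ∀ f : V → V, ∏ e ∈ mapEdges u f, G.weight e.1 e.2 =
      ∏ v ∈ univ.erase u, G.weight v (f v) := fun f =>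
    prod_image fun a _ b _ hab => congrArg Prod.fst hab
  rw [adjugate_laplacian_diag, treeEnumerator]
  symm
  have hmem : ∀ f : V → V, f ∈ (Fintype.piFinset fun v => if v = u then {u} else univ) ↔
      f u = u := by
    intro f
    rw [Fintype.mem_piFinset]
    refine ⟨fun h => by simpa using h u, fun h v => ?_⟩
    by_cases hv : v = u
    · subst hv; simp [h]
    · simp [hv]
  -- Maps that use a non-edge of `G` contribute zero; fixing `f u = u` makes the correspondence with
  -- trees injective.
  refine sum_bij_ne_zero (fun f _ _ => mapEdges u f) ?_ ?_ ?_ ?_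
  · intro f hf h0
    rw [mem_filter] at hf
    rw [orientedSpanningTrees, mem_filter]
    refine ⟨mem_univ _, ⟨?_, isTree_mapEdges_iff.2 hf.2, ?_, ?_⟩⟩
    · rintro ⟨a, b⟩ he
      rw [mem_mapEdges] at he
      obtain ⟨ha, rfl⟩ := he
      by_contra hab
      exact h0 (prod_eq_zero (mem_erase.2 ⟨ha, mem_univ _⟩) (hw _ _ hab))
    · intro x hx
      exact (mem_mapEdges.1 hx).1 rfl
    · intro v hv
      exact ⟨f v, mem_mapEdges.2 ⟨hv, rfl⟩, fun y hy => (mem_mapEdges.1 hy).2.symm⟩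
  · intro f hf _ g hg _ hfg
    rw [mem_filter, hmem] at hf hg
    funext v
    by_cases hv : v = u
    · rw [hv, hf.1, hg.1]
    · have : (v, f v) ∈ mapEdges u g := hfg ▸ mem_mapEdges.2 ⟨hv, rfl⟩
      exact (mem_mapEdges.1 this).2.symm
  · intro T hT h0
    rw [orientedSpanningTrees, mem_filter] at hT
    have hT := hT.2
    choose! f hf using fun v hv => (hT.nonroot v hv).exists
    have hTf : T = mapEdges u (Function.update f u u) := by
      ext ⟨a, b⟩
      rw [mem_mapEdges]
      constructor
      · intro h
        have ha : a ≠ u := fun ha => hT.root b (ha ▸ h)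
        rw [Function.update_of_ne ha]
        exact ⟨ha, (hT.nonroot a ha).unique (hf a ha) h⟩
      · rintro ⟨ha, rfl⟩
        rw [Function.update_of_ne ha]
        exact hf a ha
    refine ⟨Function.update f u u, ?_, ?_, hTf.symm⟩
    · rw [mem_filter, hmem, Function.update_self]
      refine ⟨rfl, isTree_mapEdges_iff.1 ?_⟩
      rw [← hTf]
      exact hT.tree
    · rwa [← hprod, ← hTf]
  · intro f _ _
    exact (hprod f).symm

/-- If the rows of `M` sum to zero, then the columns of its adjugate are constant. -/
theorem adjugate_apply_eq_of_mulVec_one [IsDomain R] {M : Matrix V V R} (hM : M *ᵥ 1 = 0)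
    (u v : V) : M.adjugate v u = M.adjugate u u := by
  -- The difference is a determinant whose row `u` is `e_v - e_u`; all its rows sum to zero, so it
  -- is singular.
  rw [← sub_eq_zero, adjugate_apply, adjugate_apply, sub_eq_add_neg,
    ← neg_one_mul (det (updateRow M u (Pi.single u 1))), ← det_updateRow_smul,
    ← det_updateRow_add, ← Matrix.exists_mulVec_eq_zero_iff]
  refine ⟨1, fun h => one_ne_zero (congrFun h u), ?_⟩
  ext x
  by_cases hx : x = u
  · subst hx
    rw [mulVec, updateRow_self, add_dotProduct, smul_dotProduct]
    simp
  · have := congrFun hM x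
    simpa [mulVec, updateRow_ne hx] using this

/-- Only column `z` changes and the determinant is affine in it; Cramer's rule gives the increment.
-/
theorem det_add_vecMulVec_single (A : Matrix V V R) (a : V → R) (z : V) :
    (A + vecMulVec a (Pi.single z 1)).det = A.det + (A.adjugate *ᵥ a) z := by
  rw [← cramer_eq_adjugate_mulVec, cramer_apply]
  nth_rw 2 [← A.updateCol_eq_self z]
  rw [← det_updateCol_add]
  congr 1
  ext i j
  by_cases hj : j = z
  · subst hj
    simp [vecMulVec_apply]
  · simp [vecMulVec_apply, hj]

theorem det_add_single_vecMulVec (A : Matrix V V R) (b : V → R) (z : V) :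
    (A + vecMulVec (Pi.single z 1) b).det = A.det + (b ᵥ* A.adjugate) z := by
  rw [← det_transpose, transpose_add, transpose_vecMulVec, det_add_vecMulVec_single,
    det_transpose, ← adjugate_transpose, mulVec_transpose]

theorem det_eq_zero_of_mulVec_one [IsDomain R] [Nonempty V] {M : Matrix V V R}
    (hM : M *ᵥ 1 = 0) : M.det = 0 :=
  Matrix.exists_mulVec_eq_zero_iff.1 ⟨1, one_ne_zero, hM⟩

end MatrixTree

/-! ### Biclique partitions as matrix factorizations -/

section Partition

variable {V : Type*} [Fintype V] [DecidableEq V]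

instance : DecidableEq (Biclique V) := fun _ _ => decidable_of_iff' _ Biclique.ext_iff

/-- The digraph `G` with all edges of weight one. -/
noncomputable def unitWeight (G : Digraph V) : WeightedDigraph V ℚ where
  toDigraph := G
  weight a b := by classical exact if G.Adj a b then 1 else 0

omit [DecidableEq V] in
theorem treeEnumerator_unitWeight (G : Digraph V) (u : V) :
    treeEnumerator (unitWeight G) u = kappa G u := by
  classical
  rw [treeEnumerator, kappa, card_eq_sum_ones, Nat.cast_sum]
  refine sum_congr rfl fun T hT => ?_
  simp only [orientedSpanningTrees, mem_filter] at hT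
  rw [Nat.cast_one]
  exact prod_eq_one fun e he => if_pos (hT.2.subgraph e he)

theorem kappa_eq_adjugate (G : Digraph V) (u : V) :
    (kappa G u : ℚ) = (laplacian (unitWeight G).weight).adjugate u u := by
  rw [← treeEnumerator_unitWeight, treeEnumerator_eq_adjugate]
  exact fun a b h => if_neg h

omit [DecidableEq V] in
theorem sum_unitWeight (G : Digraph V) (v : V) :
    ∑ x, (unitWeight G).weight v x = outDegree G v := by
  classical
  simp [unitWeight, outDegree]

/-- The incidence matrix of vertices and first parts. -/
def incidence1 (ε : Finset (Biclique V)) : Matrix V ε ℚ :=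
  of fun v Q => if v ∈ Q.1.part1 then 1 else 0

/-- The incidence matrix of second parts and vertices. -/
def incidence2 (ε : Finset (Biclique V)) : Matrix ε V ℚ :=
  of fun Q v => if v ∈ Q.1.part2 then 1 else 0

omit [Fintype V] in
theorem incidence1_mul_incidence2 {G : Digraph V} {ε : Finset (Biclique V)}
    (hε : IsBicliquePartition G ε) :
    incidence1 ε * incidence2 ε = of (unitWeight G).weight := by
  classical
  ext v x
  have h1 : ∀ Q : ε, incidence1 ε v Q * incidence2 ε Q x =
      if Q.1.toDigraph.Adj v x then 1 else 0 := by
    intro Q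
    by_cases hv : v ∈ Q.1.part1 <;> simp [incidence1, incidence2, Biclique.toDigraph, hv]
  rw [mul_apply, sum_congr rfl fun Q _ => h1 Q, of_apply]
  change _ = if G.Adj v x then (1 : ℚ) else 0
  by_cases h : G.Adj v x
  · obtain ⟨Q, ⟨hQ, hvx⟩, huniq⟩ := hε.exists_unique v x h
    rw [if_pos h, sum_eq_single ⟨Q, hQ⟩, if_pos hvx]
    · exact fun P _ hP => if_neg fun hP' => hP (Subtype.ext (huniq P.1 ⟨P.2, hP'⟩))
    · exact fun h => absurd (mem_univ _) h
  · rw [if_neg h]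
    exact sum_eq_zero fun P _ => if_neg fun hP => h (hε.subgraph P.1 P.2 _ _ hP)

theorem Theta_weight_eq (G : Digraph V) (ε : Finset (Biclique V)) :
    of (Theta G ε).weight =
      incidence2 ε * (diagonal (fun v => (outDegree G v : ℚ)⁻¹) * incidence1 ε) *
        diagonal fun Q : ε => (Q.1.part2.card : ℚ) := by
  ext P Q
  rw [mul_diagonal, mul_apply, of_apply, mul_comm]
  refine congrArg ((Q.1.part2.card : ℚ) * ·) ?_
  simp only [diagonal_mul, incidence1, incidence2, of_apply]
  rw [← sum_filter_add_sum_filter_not univ (fun v => v ∈ P.1.part2 ∩ Q.1.part1)]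
  refine Eq.symm ((add_eq_left.2 ?_).trans ?_)
  rotate_left
  · rw [filter_univ_mem]
    refine sum_congr rfl fun v hv => ?_
    rw [mem_inter] at hv
    simp [hv.1, hv.2]
  · refine sum_eq_zero fun v hv => ?_
    simp only [mem_filter, mem_inter, not_and] at hv
    by_cases h : v ∈ P.1.part2
    · simp [hv.2 h]
    · simp [h]

variable {G : Digraph V} {ε : Finset (Biclique V)}

theorem incidence2_mulVec_one : incidence2 ε *ᵥ 1 = fun Q => (Q.1.part2.card : ℚ) := by
  ext Q
  simp [incidence2, mulVec, dotProduct]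

/-- The bicliques with `v` in the first part split the out-edges of `v`, so their second parts have
total size `outDegree G v`. -/
theorem transition_mulVec_one (hε : IsBicliquePartition G ε) (hd : ∀ u, 0 < outDegree G u) :
    (diagonal (fun v => (outDegree G v : ℚ)⁻¹) * incidence1 ε *
      diagonal fun Q : ε => (Q.1.part2.card : ℚ)) *ᵥ 1 = 1 := by
  have h1 : (diagonal fun Q : ε => (Q.1.part2.card : ℚ)) *ᵥ 1 = incidence2 ε *ᵥ 1 := by
    rw [incidence2_mulVec_one]
    ext Q
    simp [mulVec_diagonal]
  rw [← mulVec_mulVec, h1, mulVec_mulVec, Matrix.mul_assoc, incidence1_mul_incidence2 hε,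
    ← mulVec_mulVec]
  ext v
  have h2 : (of (unitWeight G).weight *ᵥ 1) v = (outDegree G v : ℚ) := by
    rw [← sum_unitWeight]
    simp [mulVec, dotProduct]
  rw [mulVec_diagonal, h2, Pi.one_apply, inv_mul_cancel₀]
  exact_mod_cast (hd v).ne'

theorem laplacian_unitWeight (hε : IsBicliquePartition G ε) :
    laplacian (unitWeight G).weight =
      diagonal (fun v => (outDegree G v : ℚ)) - incidence1 ε * incidence2 ε := by
  rw [laplacian, incidence1_mul_incidence2 hε]
  simp only [sum_unitWeight]

theorem laplacian_Theta (hε : IsBicliquePartition G ε) (hd : ∀ u, 0 < outDegree G u) :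
    laplacian (Theta G ε).weight = (diagonal fun Q : ε => (Q.1.part2.card : ℚ)) -
      incidence2 ε * (diagonal (fun v => (outDegree G v : ℚ)⁻¹) * incidence1 ε) *
        diagonal fun Q : ε => (Q.1.part2.card : ℚ) := by
  rw [laplacian, ← Theta_weight_eq]
  congr 2
  ext P
  have h1 : ∑ Q, (Theta G ε).weight P Q = (of (Theta G ε).weight *ᵥ 1) P := by
    simp [mulVec, dotProduct]
  rw [h1, Theta_weight_eq, Matrix.mul_assoc, ← mulVec_mulVec, transition_mulVec_one hε hd,
    incidence2_mulVec_one]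

theorem treeEnumerator_Theta_eq_adjugate (Q : ε) :
    treeEnumerator (Theta G ε) Q = (laplacian (Theta G ε).weight).adjugate Q Q := by
  refine treeEnumerator_eq_adjugate _ (fun P Q h => ?_) _
  have h' : P.1.part2 ∩ Q.1.part1 = ∅ := not_nonempty_iff_eq_empty.1 h
  simp [Theta, h']

theorem prod_card_mul_sum_kappa (hε : IsBicliquePartition G ε) (hd : ∀ u, 0 < outDegree G u)
    (Q : ε) :
    (∏ P ∈ ε, (P.part2.card : ℚ)) * ∑ u ∈ Q.1.part1, (kappa G u : ℚ) =
      (∏ u : V, (outDegree G u : ℚ)) * treeEnumerator (Theta G ε) Q := by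
  -- Any vertex would serve as `z`: it only selects the column of the matrix unit `E`.
  obtain ⟨z, -⟩ := Q.1.nonempty1
  have : Nonempty V := ⟨z⟩
  have : Nonempty ε := ⟨Q⟩
  set B := incidence1 ε with hB
  set C := incidence2 ε
  set D := diagonal fun v => (outDegree G v : ℚ) with hD
  set D' := diagonal fun v => (outDegree G v : ℚ)⁻¹ with hD'
  set M := diagonal fun Q : ε => (Q.1.part2.card : ℚ) with hM
  set E : Matrix ε V ℚ := vecMulVec (Pi.single Q 1) (Pi.single z 1) with hE
  have hDD : D * D' = 1 := by
    rw [hD, hD', diagonal_mul_diagonal, ← diagonal_one]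
    congr 1
    ext v
    exact mul_inv_cancel₀ (by exact_mod_cast (hd v).ne')
  have h1 : laplacian (unitWeight G).weight + B * E = D * (1 - D' * B * (C - E)) := by
    rw [laplacian_unitWeight hε, Matrix.mul_sub, ← Matrix.mul_assoc, ← Matrix.mul_assoc, hDD,
      Matrix.mul_one, Matrix.one_mul, Matrix.mul_sub]
    abel
  have h2 : laplacian (Theta G ε).weight + E * (D' * B * M) =
      (1 - (C - E) * (D' * B)) * M := by
    rw [laplacian_Theta hε hd, Matrix.sub_mul, Matrix.sub_mul, Matrix.sub_mul, Matrix.one_mul,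
      ← Matrix.mul_assoc E]
    abel
  have h3 : (laplacian (unitWeight G).weight + B * E).det = ∑ u ∈ Q.1.part1, (kappa G u : ℚ) := by
    rw [hE, mul_vecMulVec, det_add_vecMulVec_single,
      det_eq_zero_of_mulVec_one (laplacian_mulVec_one _), zero_add, mulVec_single_one, mulVec,
      dotProduct, ← sum_filter_add_sum_filter_not univ (fun v => v ∈ Q.1.part1), add_eq_left.2,
      filter_univ_mem]
    · refine sum_congr rfl fun v hv => ?_
      rw [kappa_eq_adjugate, adjugate_apply_eq_of_mulVec_one (laplacian_mulVec_one _)]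
      simp [hB, incidence1, hv]
    · refine sum_eq_zero fun v hv => ?_
      rw [mem_filter] at hv
      simp [hB, incidence1, hv.2]
  have h4 : (laplacian (Theta G ε).weight + E * (D' * B * M)).det =
      treeEnumerator (Theta G ε) Q := by
    have h5 := congrFun (transition_mulVec_one hε hd) z
    rw [hE, vecMulVec_mul, det_add_single_vecMulVec,
      det_eq_zero_of_mulVec_one (laplacian_mulVec_one _), zero_add, single_one_vecMul, vecMul,
      dotProduct, treeEnumerator_Theta_eq_adjugate]
    -- Column `Q` of the adjugate is constant, which leaves row `z` of the stochastic matrix, with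
    -- sum 1.
    simp only [adjugate_apply_eq_of_mulVec_one (laplacian_mulVec_one _) Q]
    rw [← sum_mul]
    convert one_mul _
    refine Eq.trans ?_ h5
    rw [mulVec, dotProduct]
    exact sum_congr rfl fun P _ => (mul_one _).symm
  have hdM : M.det = ∏ P ∈ ε, (P.part2.card : ℚ) := by
    rw [hM, det_diagonal, ← prod_coe_sort ε fun P => (P.part2.card : ℚ)]
  rw [← h3, ← h4, h1, h2, det_mul, det_mul, det_one_sub_mul_comm, hdM, hD, det_diagonal]
  ring

/-- This is the diagonal entry at `u` of `adj L * L = det L • 1 = 0`, where row `u` of `adj L` lists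
the numbers `kappa G v`. -/
theorem sum_kappa_mul_weight (G : Digraph V) (u : V) :
    ∑ v, (kappa G v : ℚ) * (unitWeight G).weight v u = outDegree G u * kappa G u := by
  have : Nonempty V := ⟨u⟩
  have h := congrFun (congrFun (adjugate_mul (laplacian (unitWeight G).weight)) u) u
  rw [det_eq_zero_of_mulVec_one (laplacian_mulVec_one _), zero_smul, Matrix.zero_apply, mul_apply] at h
  have h1 : ∀ v, (laplacian (unitWeight G).weight).adjugate u v = kappa G v := fun v => by
    rw [kappa_eq_adjugate, adjugate_apply_eq_of_mulVec_one (laplacian_mulVec_one _)]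
  simp only [h1] at h
  simp only [laplacian, Matrix.sub_apply, of_apply, mul_sub, sum_sub_distrib,
    sum_unitWeight, diagonal_apply, mul_ite, mul_zero, sum_ite_eq', mem_univ, if_true] at h
  linarith

end Partition

end BicliqueTrees

open BicliqueTrees in
theorem theorem3p3 {V : Type*} [Fintype V] [DecidableEq V] (G : Digraph V)
    (ε : Finset (BicliqueTrees.Biclique V)) (hε : BicliqueTrees.IsBicliquePartition G ε)
    (hd : ∀ u : V, 0 < BicliqueTrees.outDegree G u) :
    (∀ u : V, (BicliqueTrees.kappa G u : ℚ) =
      (∏ v ∈ Finset.univ.erase u, (BicliqueTrees.outDegree G v : ℚ)) /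
        (∏ Q ∈ ε, (Q.part2.card : ℚ)) *
        ∑ Q : ε with u ∈ Q.1.part2,
          BicliqueTrees.treeEnumerator (BicliqueTrees.Theta G ε) Q) ∧
    (∀ Q : ε, BicliqueTrees.treeEnumerator (BicliqueTrees.Theta G ε) Q =
      (∏ P ∈ ε, (P.part2.card : ℚ)) / (∏ u : V, (BicliqueTrees.outDegree G u : ℚ)) *
        ∑ u ∈ Q.1.part1, (BicliqueTrees.kappa G u : ℚ)) := by
  have hm : (∏ P ∈ ε, (P.part2.card : ℚ)) ≠ 0 :=
    prod_ne_zero_iff.2 fun P _ => by exact_mod_cast P.nonempty2.card_pos.ne'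
  have hdv : ∀ v, (outDegree G v : ℚ) ≠ 0 := fun v => by exact_mod_cast (hd v).ne'
  have hp : (∏ u : V, (outDegree G u : ℚ)) ≠ 0 := prod_ne_zero_iff.2 fun v _ => hdv v
  have h2 : ∀ Q : ε, treeEnumerator (Theta G ε) Q =
      (∏ P ∈ ε, (P.part2.card : ℚ)) / (∏ u : V, (outDegree G u : ℚ)) *
        ∑ u ∈ Q.1.part1, (kappa G u : ℚ) := by
    intro Q
    rw [div_mul_eq_mul_div, prod_card_mul_sum_kappa hε hd, mul_div_cancel_left₀ _ hp]
  refine ⟨fun u => ?_, h2⟩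
  -- Each edge into `u` lies in exactly one biclique, so the double sum runs over the in-edges of
  -- `u`.
  have h3 : ∑ Q : ε with u ∈ Q.1.part2, ∑ v ∈ Q.1.part1, (kappa G v : ℚ) =
      outDegree G u * kappa G u := by
    rw [← sum_kappa_mul_weight, sum_filter]
    have h4 : ∀ v, (unitWeight G).weight v u = (incidence1 ε * incidence2 ε) v u := fun v => by
      rw [incidence1_mul_incidence2 hε, Matrix.of_apply]
    simp only [h4, Matrix.mul_apply, mul_sum]
    rw [sum_comm]
    refine sum_congr rfl fun Q _ => ?_
    by_cases hu : u ∈ Q.1.part2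
    · simp [incidence1, incidence2, hu]
    · simp [incidence2, hu]
  simp only [h2]
  rw [← mul_sum, h3, ← mul_prod_erase univ _ (mem_univ u)]
  have he : (∏ v ∈ univ.erase u, (outDegree G v : ℚ)) ≠ 0 := prod_ne_zero_iff.2 fun v _ => hdv v
  have := hdv u
  field_simp
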